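/- Work in max algebra over $\mathbb{R}_+=[0,\infty)$: the product of $A,B\in\mathbb{R}_+^{n\times n}$, $n\ge 1$, is $(A\otimes B)_{ij}=\max_k a_{ik}b_{kj}$, and $A$, $B$ commute if $A\otimes B=B\otimes A$. The associated digraph of $A$ has node set $\{1,\dots,n\}$ and an edge $(i,j)$ whenever $a_{ij}>0$. Call $A$ irreducible if for all $i,j$ (including $i=j$) this digraph contains a path of positive length from $i$ to $j$; that is, the digraph is strongly connected and $A$ is not the $1\times1$ zero matrix. Let $$\lambda(A)=\max_{1\le k\le n}\ \max_{i_1,\dots,i_k}\,(a_{i_1i_2}a_{i_2i_3}\cdots a_{i_ki_1})^{1/k}$$ be the maximal cycle geometric mean of $A$. A critical cycle of $A$ is a cycle of the associated digraph whose geometric mean equals $\lambda(A)$, and the critical digraph $\mathrm{crit}(A)$ consists of all nodes and edges lying on critical cycles; its nodes are called eigennodes (critical nodes) of $A$. Theorem. Let $A,B\in\mathbb{R}_+^{n\times n}$ be irreducible matrices that commute in max algebra. Then there exists a cycle $c_1$ in $\mathrm{crit}(A)$ such that every node of $c_1$ belongs to a strongly connected component of $\mathrm{crit}(B)$, and there exists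 a cycle $c_2$ in $\mathrm{crit}(B)$ such that every node of $c_2$ belongs to a strongly connected component of $\mathrm{crit}(A)$. In particular, $A$ and $B$ have a common eigennode. -/

import Mathlib

open scoped NNReal

namespace MaxAlgebra

/-- A digraph `(N, E)` with node set `N` inside an ambient type `V`, loops allowed. -/
structure NodeDigraph (V : Type*) where
  /-- the node set -/
  nodes : Set V
  /-- the edge relation -/
  Edge : V → V → Prop
  /-- edges join nodes of the digraph -/
  edge_mem : ∀ {i j : V}, Edge i j → i ∈ nodes ∧ j ∈ nodes

namespace NodeDigraph

variable {V : Type*}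

/-- The sequence `c 0, …, c k` of pairwise distinct nodes is a cycle (of length `k + 1`) of `G`.
The addition `t + 1` in `Fin (k + 1)` is cyclic, so the last edge goes from `c k` to `c 0`;
for `k = 0` the cycle is a loop. -/
def IsCycle (G : NodeDigraph V) {k : ℕ} (c : Fin (k + 1) → V) : Prop :=
  Function.Injective c ∧ ∀ t, G.Edge (c t) (c (t + 1))

/-- `j` can be reached from `i` by a (possibly empty) path of `G`. -/
def Reaches (G : NodeDigraph V) (i j : V) : Prop :=
  Relation.ReflTransGen G.Edge i j

/-- `S` is the node set of a strongly connected component of `G`. -/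
def IsStrongComponent (G : NodeDigraph V) (S : Set V) : Prop :=
  ∃ i ∈ G.nodes, S = {j | j ∈ G.nodes ∧ G.Reaches i j ∧ G.Reaches j i}

end NodeDigraph

variable {n : ℕ}

/-- The max-algebra product `A ⊗ B`, with entries `max_k a_{ik} b_{kj}`. -/
noncomputable def maxMul (A B : Matrix (Fin n) (Fin n) ℝ≥0) : Matrix (Fin n) (Fin n) ℝ≥0 :=
  fun i j => Finset.univ.sup fun k => A i k * B k j

/-- `A` and `B` commute in max algebra. -/
def MaxCommute (A B : Matrix (Fin n) (Fin n) ℝ≥0) : Prop :=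
  maxMul A B = maxMul B A

/-- `A` is irreducible: any two nodes are joined by a path of positive length in the digraph
of the positive entries of `A`. -/
def IsIrreducible (A : Matrix (Fin n) (Fin n) ℝ≥0) : Prop :=
  (A.map ((↑) : ℝ≥0 → ℝ)).IsIrreducible

/-- The associated digraph of `A`: its nodes are all indices, and `(i, j)` is an edge whenever
`a_{ij} > 0`. -/
def assocDigraph (A : Matrix (Fin n) (Fin n) ℝ≥0) : NodeDigraph (Fin n) where
  nodes := Set.univ
  Edge i j := 0 < A i j
  edge_mem _ := ⟨Set.mem_univ _, Set.mem_univ _⟩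

/-- The geometric mean `(a_{i_1 i_2} ⋯ a_{i_m i_1})^{1/m}` of the entries of `A` along a closed
sequence of `m = k + 1` indices. -/
noncomputable def cycleMean (A : Matrix (Fin n) (Fin n) ℝ≥0) {k : ℕ}
    (c : Fin (k + 1) → Fin n) : ℝ≥0 :=
  (∏ t, A (c t) (c (t + 1))) ^ (1 / ((k : ℝ) + 1))

/-- The Perron root `λ(A)` as the maximal cycle geometric mean: the maximum of `cycleMean A c` over
all closed sequences of at most `n` indices. -/
noncomputable def perronRoot (A : Matrix (Fin n) (Fin n) ℝ≥0) : ℝ≥0 :=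
  (Finset.range n).sup fun k => Finset.univ.sup fun c : Fin (k + 1) → Fin n => cycleMean A c

/-- A critical cycle of `A`: a cycle of the associated digraph whose geometric mean is `λ(A)`. -/
def IsCriticalCycle (A : Matrix (Fin n) (Fin n) ℝ≥0) {k : ℕ} (c : Fin (k + 1) → Fin n) : Prop :=
  (assocDigraph A).IsCycle c ∧ cycleMean A c = perronRoot A

/-- The critical digraph of `A`: all nodes and edges on critical cycles. Its nodes are the
critical nodes, or eigennodes, of `A`. -/
def crit (A : Matrix (Fin n) (Fin n) ℝ≥0) : NodeDigraph (Fin n) where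
  nodes := {i | ∃ (k : ℕ) (c : Fin (k + 1) → Fin n), IsCriticalCycle A c ∧ ∃ t, c t = i}
  Edge i j := ∃ (k : ℕ) (c : Fin (k + 1) → Fin n),
    IsCriticalCycle A c ∧ ∃ t, c t = i ∧ c (t + 1) = j
  edge_mem := by
    rintro i j ⟨k, c, hc, t, hi, hj⟩
    exact ⟨⟨k, c, hc, t, hi⟩, ⟨k, c, hc, t + 1, hj⟩⟩

end MaxAlgebra

/-!
If `A` is irreducible, nonzero solutions of `A ⊗ x ≤ μ x` are positive. Minimising `μ` over a
closed max cone of such vectors yields an eigenvector in the cone (Collatz–Wielandt); doing this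
for `A` among its subeigenvectors, and then for `B` in the resulting eigencone of `A`, produces a
common positive eigenvector `w` of `A` and `B`. The entries with `a_{ij} w_j = λ(A) w_i` form a
digraph whose cycles are critical, likewise for `B`, and since `A` and `B` commute so do these two
relations. Being serial and finite, they admit a cycle of the first all of whose nodes lie on cycles
of the second.
-/

open Relation Filter Topology

namespace MaxAlgebra

section Digraph

variable {V : Type*} {P Q R : V → V → Prop}

theorem exists_nodup_isChain_of_reflTransGen {a b : V} (h : ReflTransGen R a b) :
    ∃ l : List V, (a :: l).Nodup ∧ (a :: l).IsChain R ∧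
      (a :: l).getLast (List.cons_ne_nil a l) = b := by
  induction h using ReflTransGen.head_induction_on with
  | refl => exact ⟨[], by simp⟩
  | @head a c hac _ ih =>
    obtain ⟨l, hnodup, hchain, hlast⟩ := ih
    by_cases ha : a ∈ c :: l
    · obtain ⟨s, t, hst⟩ := List.append_of_mem ha
      have hsuffix : a :: t <:+ c :: l := ⟨s, hst.symm⟩
      exact ⟨t, hnodup.sublist hsuffix.sublist, hchain.suffix hsuffix,
        (hsuffix.getLast _).trans hlast⟩
    · exact ⟨c :: l, List.nodup_cons.2 ⟨ha, hnodup⟩, hchain.cons_cons hac, hlast⟩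

theorem exists_cycle_of_transGen {i : V} (h : TransGen R i i) :
    ∃ (k : ℕ) (c : Fin (k + 1) → V),
      Function.Injective c ∧ c 0 = i ∧ ∀ t, R (c t) (c (t + 1)) := by
  obtain ⟨b, hib, hbi⟩ := TransGen.tail'_iff.1 h
  obtain ⟨l, hnodup, hchain, hlast⟩ := exists_nodup_isChain_of_reflTransGen hib
  refine ⟨l.length, (i :: l).get, List.nodup_iff_injective_get.1 hnodup, rfl, fun t => ?_⟩
  induction t using Fin.lastCases with
  | last =>
    have hget : (i :: l).get (Fin.last l.length) = b := by
      rw [← hlast, List.getLast_eq_getElem]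
      rfl
    rwa [Fin.last_add_one, hget]
  | cast t =>
    rw [Fin.coeSucc_eq_succ]
    exact List.isChain_iff_getElem.1 hchain t (by simp)

theorem exists_transGen_self [Finite V] {S : Set V} (hS : S.Nonempty)
    (h : ∀ i ∈ S, ∃ j ∈ S, R i j) : ∃ i ∈ S, TransGen R i i := by
  by_contra! hacyclic
  let r : S → S → Prop := fun i j => TransGen R j i
  have : IsTrans S r := ⟨fun _ _ _ hij hjk => hjk.trans hij⟩
  have : Std.Irrefl r := ⟨fun i => hacyclic i i.2⟩
  have : Nonempty S := hS.to_subtype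
  obtain ⟨m, -, hm⟩ :=
    (Finite.wellFounded_of_trans_of_irrefl r).has_min Set.univ Set.univ_nonempty
  obtain ⟨j, hj, hmj⟩ := h m m.2
  exact hm ⟨j, hj⟩ trivial (.single hmj)

theorem comp_transGen_le (hQP : Comp Q P ≤ Comp P Q) :
    Comp (TransGen Q) P ≤ Comp P (TransGen Q) := by
  rintro i k ⟨j, hij, hjk⟩
  induction hij generalizing k with
  | single hij =>
    obtain ⟨l, hil, hlk⟩ := hQP _ _ ⟨_, hij, hjk⟩
    exact ⟨l, hil, .single hlk⟩
  | tail _ hjj' ih =>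
    obtain ⟨l, hjl, hlk⟩ := hQP _ _ ⟨_, hjj', hjk⟩
    obtain ⟨m, him, hml⟩ := ih l hjl
    exact ⟨m, him, hml.tail hlk⟩

/- Going around the `Q`-cycle at `i` sends each `P`-successor of `i` back to another one, and on a
finite set this must close up. -/
theorem exists_succ_transGen_self [Finite V] (hP : ∀ i, ∃ j, P i j)
    (hQP : Comp Q P ≤ Comp P Q) {i : V} (hi : TransGen Q i i) :
    ∃ j, P i j ∧ TransGen Q j j := by
  obtain ⟨j, hij, hj⟩ := exists_transGen_self (R := Function.swap (TransGen Q))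
    (S := {j | P i j}) (hP i) fun j hij => comp_transGen_le hQP i j ⟨i, hi, hij⟩
  exact ⟨j, hij, by rwa [transGen_swap, transGen_eq_self] at hj⟩

theorem exists_cycle_forall_transGen_self [Finite V] [Nonempty V] (hP : ∀ i, ∃ j, P i j)
    (hQ : ∀ i, ∃ j, Q i j) (hQP : Comp Q P ≤ Comp P Q) :
    ∃ (k : ℕ) (c : Fin (k + 1) → V),
      Function.Injective c ∧ (∀ t, P (c t) (c (t + 1))) ∧ ∀ t, TransGen Q (c t) (c t) := by
  obtain ⟨i, -, hi⟩ := exists_transGen_self (R := Q) Set.univ_nonempty fun i _ =>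
    (hQ i).imp fun _ hij => ⟨trivial, hij⟩
  obtain ⟨j, -, hj⟩ := exists_transGen_self (S := {i | TransGen Q i i})
    (R := fun a b => P a b ∧ TransGen Q a a) ⟨i, hi⟩ fun a ha =>
      (exists_succ_transGen_self hP hQP ha).imp fun _ h => ⟨h.2, h.1, ha⟩
  obtain ⟨k, c, hc, -, hcycle⟩ := exists_cycle_of_transGen hj
  exact ⟨k, c, hc, fun t => (hcycle t).1, fun t => (hcycle t).2⟩

theorem NodeDigraph.exists_isStrongComponent_mem {G : NodeDigraph V} {i : V} (hi : i ∈ G.nodes) :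
    ∃ S, G.IsStrongComponent S ∧ i ∈ S :=
  ⟨_, ⟨i, hi, rfl⟩, hi, .refl, .refl⟩

end Digraph

section MaxMulVec

variable {m ι : Type*} [Fintype ι]

/-- The max-algebra matrix-vector product `A ⊗ x`, with entries `max_j a_{ij} x_j`. -/
noncomputable def maxMulVec (A : Matrix m ι ℝ≥0) (x : ι → ℝ≥0) : m → ℝ≥0 :=
  fun i => Finset.univ.sup fun j => A i j * x j

theorem mul_le_maxMulVec (A : Matrix m ι ℝ≥0) (x : ι → ℝ≥0) (i : m) (j : ι) :
    A i j * x j ≤ maxMulVec A x i :=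
  Finset.le_sup (f := fun j => A i j * x j) (Finset.mem_univ j)

theorem exists_maxMulVec_eq [Nonempty ι] (A : Matrix m ι ℝ≥0) (x : ι → ℝ≥0) (i : m) :
    ∃ j, maxMulVec A x i = A i j * x j := by
  obtain ⟨j, -, hj⟩ := Finset.exists_mem_eq_sup Finset.univ Finset.univ_nonempty
    fun j => A i j * x j
  exact ⟨j, hj⟩

theorem maxMulVec_sup (A : Matrix m ι ℝ≥0) (x y : ι → ℝ≥0) :
    maxMulVec A (x ⊔ y) = maxMulVec A x ⊔ maxMulVec A y := by
  ext1 i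
  simp only [maxMulVec, Pi.sup_apply, mul_max]
  exact Finset.sup_sup

theorem maxMulVec_zero (A : Matrix m ι ℝ≥0) : maxMulVec A 0 = 0 := by
  ext1 i
  simp [maxMulVec]

theorem maxMulVec_finset_sup {κ : Type*} (A : Matrix m ι ℝ≥0) (s : Finset κ)
    (x : κ → ι → ℝ≥0) : maxMulVec A (s.sup x) = s.sup fun k => maxMulVec A (x k) :=
  Finset.apply_sup_eq_sup_comp (maxMulVec A) (maxMulVec_sup A) (maxMulVec_zero A)

theorem maxMulVec_mono (A : Matrix m ι ℝ≥0) : Monotone (maxMulVec A) :=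
  fun _ _ h i => Finset.sup_mono_fun fun j _ => mul_le_mul_right (h j) (A i j)

theorem continuous_maxMulVec (A : Matrix m ι ℝ≥0) : Continuous (maxMulVec A) :=
  continuous_pi fun _ => Continuous.finset_sup_apply fun _ _ => by fun_prop

theorem maxMulVec_smul (A : Matrix m ι ℝ≥0) (a : ℝ≥0) (x : ι → ℝ≥0) :
    maxMulVec A (a • x) = a • maxMulVec A x := by
  ext1 i
  simp only [maxMulVec, Pi.smul_apply, smul_eq_mul, NNReal.mul_finset_sup, mul_left_comm]

theorem smul_maxMulVec (A : Matrix m ι ℝ≥0) (a : ℝ≥0) (x : ι → ℝ≥0) :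
    maxMulVec (a • A) x = a • maxMulVec A x := by
  ext1 i
  simp only [maxMulVec, Matrix.smul_apply, Pi.smul_apply, smul_eq_mul, NNReal.mul_finset_sup,
    mul_assoc]

theorem maxMulVec_maxMul {n : ℕ} (A B : Matrix (Fin n) (Fin n) ℝ≥0) (x : Fin n → ℝ≥0) :
    maxMulVec (maxMul A B) x = maxMulVec A (maxMulVec B x) := by
  ext1 i
  simp only [maxMulVec, maxMul, NNReal.mul_finset_sup, NNReal.finset_sup_mul, mul_assoc]
  exact Finset.sup_comm _ _ _

end MaxMulVec

section MaxCone

variable {ι : Type*} {K : Set (ι → ℝ≥0)}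

/-- A closed max cone: the max-algebra analogue of a closed convex cone, with the componentwise
maximum in the role of addition. -/
structure IsClosedMaxCone (K : Set (ι → ℝ≥0)) : Prop where
  isClosed : IsClosed K
  smul_mem : ∀ (a : ℝ≥0), ∀ x ∈ K, a • x ∈ K
  sup_mem : ∀ x ∈ K, ∀ y ∈ K, x ⊔ y ∈ K

theorem IsClosedMaxCone.finset_sup_mem {κ : Type*} (hK : IsClosedMaxCone K) {s : Finset κ}
    (hs : s.Nonempty) {x : κ → ι → ℝ≥0} (hx : ∀ k ∈ s, x k ∈ K) : s.sup x ∈ K := by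
  rw [← Finset.sup'_eq_sup hs]
  exact Finset.sup'_mem K hK.sup_mem s hs x hx

variable [Fintype ι] {A : Matrix ι ι ℝ≥0} {μ : ℝ≥0}

theorem isClosedMaxCone_setOf_maxMulVec_le (A : Matrix ι ι ℝ≥0) (μ : ℝ≥0) :
    IsClosedMaxCone {x | maxMulVec A x ≤ μ • x} where
  isClosed := isClosed_le (continuous_maxMulVec A) (continuous_const_smul μ)
  smul_mem a x hx := by
    rw [Set.mem_ofPred_eq, maxMulVec_smul, smul_comm]
    exact smul_le_smul_of_nonneg_left hx zero_le
  sup_mem x hx y hy := by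
    rw [Set.mem_ofPred_eq, maxMulVec_sup]
    exact sup_le (hx.trans (smul_le_smul_of_nonneg_left le_sup_left zero_le))
      (hy.trans (smul_le_smul_of_nonneg_left le_sup_right zero_le))

theorem isClosedMaxCone_setOf_maxMulVec_eq (A : Matrix ι ι ℝ≥0) (μ : ℝ≥0) :
    IsClosedMaxCone {x | maxMulVec A x = μ • x} where
  isClosed := isClosed_eq (continuous_maxMulVec A) (continuous_const_smul μ)
  smul_mem a x hx := by rw [Set.mem_ofPred_eq, maxMulVec_smul, hx.out, smul_comm]
  sup_mem x hx y hy := by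
    rw [Set.mem_ofPred_eq, maxMulVec_sup, hx.out, hy.out]
    ext1 i
    simp only [Pi.sup_apply, Pi.smul_apply, smul_eq_mul, mul_max]

/-- The numbers `μ` for which `K` contains a nonzero `μ`-subeigenvector of `A`. Their minimum is the
Collatz–Wielandt number of `A` on `K`. -/
def subeigenvalues (A : Matrix ι ι ℝ≥0) (K : Set (ι → ℝ≥0)) : Set ℝ≥0 :=
  {μ | ∃ x ∈ K, x ≠ 0 ∧ maxMulVec A x ≤ μ • x}

theorem subeigenvalues_nonempty {x : ι → ℝ≥0} (hx : x ∈ K) (hx₀ : x ≠ 0) (hpos : ∀ i, 0 < x i) :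
    (subeigenvalues A K).Nonempty := by
  refine ⟨Finset.univ.sup fun i => maxMulVec A x i / x i, x, hx, hx₀, fun i => ?_⟩
  rw [Pi.smul_apply, smul_eq_mul, ← div_le_iff₀ (hpos i)]
  exact Finset.le_sup (f := fun i => maxMulVec A x i / x i) (Finset.mem_univ i)

theorem mem_subeigenvalues_of_mem_smul {a : ℝ≥0} (ha : 0 < a)
    (h : μ ∈ subeigenvalues (a⁻¹ • A) K) : a * μ ∈ subeigenvalues A K := by
  obtain ⟨x, hx, hx₀, hle⟩ := h
  rw [smul_maxMulVec, inv_smul_le_iff_of_pos ha, smul_smul] at hle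
  exact ⟨x, hx, hx₀, hle⟩

namespace IsClosedMaxCone

theorem mem_subeigenvalues_iff (hK : IsClosedMaxCone K) :
    μ ∈ subeigenvalues A K ↔
      ∃ x ∈ K, Finset.univ.sup x = 1 ∧ maxMulVec A x ≤ μ • x := by
  constructor
  · rintro ⟨x, hx, hx₀, hle⟩
    have hsup : Finset.univ.sup x ≠ 0 := fun h =>
      hx₀ (funext fun i => by simpa using (Finset.sup_eq_bot_iff x _).1 h i (Finset.mem_univ i))
    refine ⟨(Finset.univ.sup x)⁻¹ • x, hK.smul_mem _ x hx, ?_, ?_⟩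
    · rw [← inv_mul_cancel₀ hsup, NNReal.mul_finset_sup]
      rfl
    · rw [maxMulVec_smul, smul_comm μ]
      exact smul_le_smul_of_nonneg_left hle zero_le
  · rintro ⟨x, hx, hsup, hle⟩
    refine ⟨x, hx, ?_, hle⟩
    rintro rfl
    exact zero_ne_one ((Finset.sup_bot _).symm.trans hsup)

theorem isClosed_subeigenvalues (hK : IsClosedMaxCone K) : IsClosed (subeigenvalues A K) := by
  have hclosed : IsClosed {p : ℝ≥0 × Set.Icc (0 : ι → ℝ≥0) 1 | p.2.1 ∈ K ∧
      Finset.univ.sup p.2.1 = 1 ∧ maxMulVec A p.2.1 ≤ p.1 • p.2.1} := by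
    have hsup : Continuous fun x : ι → ℝ≥0 => Finset.univ.sup x :=
      Continuous.finset_sup_apply fun i _ => continuous_apply i
    exact (hK.isClosed.preimage (by fun_prop)).inter
      ((isClosed_eq (hsup.comp (by fun_prop)) continuous_const).inter
        (isClosed_le ((continuous_maxMulVec A).comp (by fun_prop)) (by fun_prop)))
  convert isClosedMap_fst_of_compactSpace _ hclosed using 1
  ext μ
  rw [hK.mem_subeigenvalues_iff]
  constructor
  · rintro ⟨x, hx, hsup, hle⟩
    have hx₁ : x ≤ 1 := fun i => (Finset.le_sup (Finset.mem_univ i)).trans_eq hsup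
    exact ⟨(μ, ⟨x, zero_le, hx₁⟩), ⟨hx, hsup, hle⟩, rfl⟩
  · rintro ⟨⟨_, x⟩, ⟨hx, hsup, hle⟩, rfl⟩
    exact ⟨x, hx, hsup, hle⟩

/- With `c⁻ʲ Aʲ x` in the role of the terms of a geometric series, the witness is
`max_{j < k} c⁻ʲ Aʲ x`: applying `c⁻¹ A` shifts the index, and the last term is absorbed by `x`. -/
theorem mem_subeigenvalues_of_iterate_le (hK : IsClosedMaxCone K)
    (hKA : Set.MapsTo (maxMulVec A) K K) {x : ι → ℝ≥0} (hx : x ∈ K) (hx₀ : x ≠ 0) {k : ℕ}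
    (hk : k ≠ 0) {c : ℝ≥0} (hc : 0 < c) (hle : (maxMulVec A)^[k] x ≤ c ^ k • x) :
    c ∈ subeigenvalues A K := by
  let y : ℕ → ι → ℝ≥0 := fun j => (c ^ j)⁻¹ • (maxMulVec A)^[j] x
  have hy₀ : y 0 = x := by simp [y]
  have hyk : y k ≤ x := (inv_smul_le_iff_of_pos (pow_pos hc k)).2 hle
  have hy_succ (j : ℕ) : maxMulVec A (y j) = c • y (j + 1) := by
    rw [maxMulVec_smul, ← Function.iterate_succ_apply' (maxMulVec A), smul_smul, pow_succ, mul_inv,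
      mul_left_comm, mul_inv_cancel₀ hc.ne', mul_one]
  have hx_le : x ≤ (Finset.range k).sup y :=
    hy₀.symm.trans_le (Finset.le_sup (Finset.mem_range.2 (Nat.pos_of_ne_zero hk)))
  refine ⟨(Finset.range k).sup y, hK.finset_sup_mem (by simpa using hk) fun j _ =>
    hK.smul_mem _ _ (hKA.iterate j hx), fun h => hx₀ (le_bot_iff.1 (hx_le.trans_eq h)), ?_⟩
  rw [maxMulVec_finset_sup]
  refine Finset.sup_le fun j hj => ?_
  rw [hy_succ]
  refine smul_le_smul_of_nonneg_left ?_ zero_le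
  rcases (Nat.succ_le_of_lt (Finset.mem_range.1 hj)).lt_or_eq with hlt | heq
  · exact Finset.le_sup (Finset.mem_range.2 hlt)
  · exact (heq ▸ hyk).trans hx_le

end IsClosedMaxCone

theorem exists_tendsto_iterate_of_maxMulVec_le {x : ι → ℝ≥0} (hx : maxMulVec A x ≤ x) :
    ∃ y, Tendsto (fun k => (maxMulVec A)^[k] x) atTop (𝓝 y) := by
  have hanti : Antitone fun k => (maxMulVec A)^[k] x :=
    (maxMulVec_mono A).antitone_iterate_of_map_le hx
  exact ⟨fun i => ⨅ k, (maxMulVec A)^[k] x i, tendsto_pi_nhds.2 fun i =>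
    tendsto_atTop_ciInf (fun _ _ h => hanti h i) (OrderBot.bddBelow _)⟩

namespace IsClosedMaxCone

theorem exists_maxMulVec_eq_self (hK : IsClosedMaxCone K) (hKA : Set.MapsTo (maxMulVec A) K K)
    (hpos : ∀ x ∈ K, x ≠ 0 → ∀ i, 0 < x i) (hleast : IsLeast (subeigenvalues A K) 1) :
    ∃ x ∈ K, x ≠ 0 ∧ maxMulVec A x = x := by
  obtain ⟨⟨x, hx, hx₀, hle⟩, hmin⟩ := hleast
  rw [one_smul] at hle
  obtain ⟨y, hy⟩ := exists_tendsto_iterate_of_maxMulVec_le hle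
  refine ⟨y, hK.isClosed.mem_of_tendsto hy (.of_forall fun k => hKA.iterate k hx), ?_,
    isFixedPt_of_tendsto_iterate hy (continuous_maxMulVec A).continuousAt⟩
  -- If the iterates decayed to zero, some power would halve `x`, contradicting minimality.
  rintro rfl
  have hhalf : ∀ᶠ k in atTop, ∀ i, (maxMulVec A)^[k] x i < 2⁻¹ * x i :=
    eventually_all.2 fun i => (tendsto_pi_nhds.1 hy i).eventually_lt_const
      (mul_pos (by norm_num) (hpos x hx hx₀ i))
  obtain ⟨k, hk, hk₀⟩ := (hhalf.and (eventually_ne_atTop 0)).exists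
  let c : ℝ≥0 := 2⁻¹ ^ (k⁻¹ : ℝ)
  have hck : c ^ k = 2⁻¹ := NNReal.rpow_inv_natCast_pow _ hk₀
  have hc : c ∈ subeigenvalues A K :=
    hK.mem_subeigenvalues_of_iterate_le hKA hx hx₀ hk₀ (NNReal.rpow_pos (by norm_num))
      fun i => by rw [hck]; exact (hk i).le
  have : (1 : ℝ≥0) ≤ 2⁻¹ := (one_le_pow₀ (hmin hc)).trans_eq hck
  exact absurd this (by norm_num)

theorem exists_maxMulVec_eq_smul (hK : IsClosedMaxCone K) (hKA : Set.MapsTo (maxMulVec A) K K)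
    (hne : ∃ x ∈ K, x ≠ 0) (hpos : ∀ x ∈ K, x ≠ 0 → ∀ i, 0 < x i) :
    ∃ μ : ℝ≥0, ∃ x ∈ K, x ≠ 0 ∧ maxMulVec A x = μ • x := by
  obtain ⟨x, hx, hx₀⟩ := hne
  obtain ⟨μ, hμ⟩ : ∃ μ, IsLeast (subeigenvalues A K) μ :=
    ⟨_, hK.isClosed_subeigenvalues.isLeast_csInf
      (subeigenvalues_nonempty hx hx₀ (hpos x hx hx₀)) (OrderBot.bddBelow _)⟩
  rcases eq_zero_or_pos μ with rfl | hμ₀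
  · obtain ⟨⟨y, hy, hy₀, hle⟩, -⟩ := hμ
    rw [zero_smul] at hle
    exact ⟨0, y, hy, hy₀, by rw [zero_smul]; exact le_bot_iff.1 hle⟩
  · have hleast : IsLeast (subeigenvalues (μ⁻¹ • A) K) 1 := by
      obtain ⟨⟨y, hy, hy₀, hle⟩, hmin⟩ := hμ
      refine ⟨⟨y, hy, hy₀, ?_⟩, fun ν hν => ?_⟩
      · rwa [smul_maxMulVec, one_smul, inv_smul_le_iff_of_pos hμ₀]
      · exact le_of_mul_le_mul_left
          ((mul_one μ).trans_le (hmin (mem_subeigenvalues_of_mem_smul hμ₀ hν))) hμ₀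
    obtain ⟨y, hy, hy₀, hfix⟩ := hK.exists_maxMulVec_eq_self
      (fun z hz => by rw [smul_maxMulVec]; exact hK.smul_mem _ _ (hKA hz)) hpos hleast
    rw [smul_maxMulVec, inv_smul_eq_iff₀ hμ₀.ne'] at hfix
    exact ⟨μ, y, hy, hy₀, hfix⟩

end IsClosedMaxCone

end MaxCone

variable {n : ℕ} {A B : Matrix (Fin n) (Fin n) ℝ≥0} {w : Fin n → ℝ≥0} {μ ν : ℝ≥0}

theorem MaxCommute.symm (h : MaxCommute A B) : MaxCommute B A :=
  Eq.symm h

theorem MaxCommute.maxMulVec_comm (h : MaxCommute A B) (x : Fin n → ℝ≥0) :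
    maxMulVec A (maxMulVec B x) = maxMulVec B (maxMulVec A x) := by
  rw [← maxMulVec_maxMul, h, maxMulVec_maxMul]

theorem IsIrreducible.ne_zero [Nonempty (Fin n)] (hA : IsIrreducible A) : A ≠ 0 := by
  rintro rfl
  let : Quiver (Fin n) := Matrix.toQuiver ((0 : Matrix (Fin n) (Fin n) ℝ≥0).map ((↑) : ℝ≥0 → ℝ))
  inhabit Fin n
  obtain ⟨p, hp⟩ := hA.connected default default
  cases p with
  | nil => exact hp.false
  | cons _ e => exact lt_irrefl (0 : ℝ) (by simpa using e.down)

theorem IsIrreducible.pos_of_maxMulVec_le (hA : IsIrreducible A) (hw : maxMulVec A w ≤ μ • w)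
    (hw₀ : w ≠ 0) (i : Fin n) : 0 < w i := by
  let : Quiver (Fin n) := Matrix.toQuiver (A.map ((↑) : ℝ≥0 → ℝ))
  have pos_of_path {i j : Fin n} (p : Quiver.Path i j) : 0 < w j → 0 < w i := by
    induction p with
    | nil => exact id
    | @cons b c _ e ih =>
      intro hc
      have hbc : 0 < A b c := NNReal.coe_pos.1 e.down
      have hle : A b c * w c ≤ μ * w b := (mul_le_maxMulVec A w b c).trans (hw b)
      exact ih (pos_of_mul_pos_right ((mul_pos hbc hc).trans_le hle) zero_le)
  obtain ⟨j, hj⟩ := Function.ne_iff.1 hw₀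
  obtain ⟨p, -⟩ := hA.connected i j
  exact pos_of_path p (pos_iff_ne_zero.2 hj)

theorem IsIrreducible.exists_pos_eigenvector [Nonempty (Fin n)] (hA : IsIrreducible A) :
    ∃ (μ : ℝ≥0) (w : Fin n → ℝ≥0), (∀ i, 0 < w i) ∧ maxMulVec A w = μ • w := by
  obtain ⟨M, x, -, hx₀, hx⟩ := subeigenvalues_nonempty (A := A) (Set.mem_univ 1) one_ne_zero
    fun _ => one_pos
  obtain ⟨μ, w, hw, hw₀, hμ⟩ := (isClosedMaxCone_setOf_maxMulVec_le A M).exists_maxMulVec_eq_smul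
    (A := A)
    (fun y hy => by
      rw [Set.mem_ofPred_eq, ← maxMulVec_smul]
      exact maxMulVec_mono A hy)
    ⟨x, hx, hx₀⟩ fun y hy => hA.pos_of_maxMulVec_le hy
  exact ⟨μ, w, hA.pos_of_maxMulVec_le hw hw₀, hμ⟩

theorem MaxCommute.exists_common_pos_eigenvector [Nonempty (Fin n)] (hAB : MaxCommute A B)
    (hA : IsIrreducible A) :
    ∃ (μ ν : ℝ≥0) (w : Fin n → ℝ≥0),
      (∀ i, 0 < w i) ∧ maxMulVec A w = μ • w ∧ maxMulVec B w = ν • w := by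
  obtain ⟨μ, x, hx, hμ⟩ := hA.exists_pos_eigenvector
  have hx₀ : x ≠ 0 := fun h => (hx (Classical.arbitrary _)).ne' (congrFun h _)
  obtain ⟨ν, w, hw, hw₀, hν⟩ := (isClosedMaxCone_setOf_maxMulVec_eq A μ).exists_maxMulVec_eq_smul
    (A := B)
    (fun y hy => by rw [Set.mem_ofPred_eq, hAB.maxMulVec_comm, hy.out, maxMulVec_smul])
    ⟨x, hμ, hx₀⟩ fun y hy => hA.pos_of_maxMulVec_le hy.out.le
  exact ⟨μ, ν, w, hA.pos_of_maxMulVec_le hw.out.le hw₀, hw, hν⟩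

theorem eigenvalue_pos (hA : A ≠ 0) (hw : ∀ i, 0 < w i) (hAw : maxMulVec A w = μ • w) : 0 < μ := by
  rw [pos_iff_ne_zero]
  rintro rfl
  refine hA (Matrix.ext fun i j => ?_)
  have hle : A i j * w j ≤ 0 := by simpa [hAw] using mul_le_maxMulVec A w i j
  exact (mul_eq_zero.1 (le_bot_iff.1 hle)).resolve_right (hw j).ne'

/-- The edge relation of the saturation digraph of a `μ`-eigenvector `w` of `A`: the pairs `(i, j)`
for which the maximum in `(A ⊗ w)_i = μ w_i` is attained at `j`. -/
def IsSaturated (A : Matrix (Fin n) (Fin n) ℝ≥0) (μ : ℝ≥0) (w : Fin n → ℝ≥0) (i j : Fin n) : Prop :=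
  A i j * w j = μ * w i

theorem exists_isSaturated (hAw : maxMulVec A w = μ • w) (i : Fin n) :
    ∃ j, IsSaturated A μ w i j := by
  have : Nonempty (Fin n) := ⟨i⟩
  exact (exists_maxMulVec_eq A w i).imp fun _ h => h.symm.trans (congrFun hAw i)

theorem IsSaturated.apply_pos {i j : Fin n} (h : IsSaturated A μ w i j) (hμ : 0 < μ)
    (hw : ∀ i, 0 < w i) : 0 < A i j :=
  pos_of_mul_pos_left ((mul_pos hμ (hw i)).trans_eq h.symm) zero_le

theorem MaxCommute.comp_isSaturated_le (hAB : MaxCommute A B) (hμ : 0 < μ) (hν : 0 < ν)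
    (hw : ∀ i, 0 < w i) (hAw : maxMulVec A w = μ • w) (hBw : maxMulVec B w = ν • w) :
    Comp (IsSaturated B ν w) (IsSaturated A μ w) ≤
      Comp (IsSaturated A μ w) (IsSaturated B ν w) := by
  rintro i k ⟨j, hij, hjk⟩
  have : Nonempty (Fin n) := ⟨i⟩
  obtain ⟨l, -, hl⟩ := Finset.exists_mem_eq_sup Finset.univ Finset.univ_nonempty
    fun l => A i l * B l k
  have hlk : B l k * w k ≤ ν * w l := (mul_le_maxMulVec B w l k).trans_eq (congrFun hBw l)
  have hil : A i l * w l ≤ μ * w i := (mul_le_maxMulVec A w i l).trans_eq (congrFun hAw i)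
  have hge : μ * (ν * w i) ≤ A i l * (B l k * w k) :=
    calc μ * (ν * w i) = B i j * A j k * w k := by
          rw [← show B i j * w j = ν * w i from hij, mul_left_comm,
            ← show A j k * w k = μ * w j from hjk, mul_assoc]
      _ ≤ maxMul B A i k * w k := by
        gcongr
        exact Finset.le_sup (f := fun j => B i j * A j k) (Finset.mem_univ j)
      _ = maxMul A B i k * w k := by rw [hAB]
      _ = A i l * (B l k * w k) := by rw [← mul_assoc]; exact congrArg (· * w k) hl
  have hil_eq : IsSaturated A μ w i l := by
    refine hil.antisymm (le_of_mul_le_mul_left ?_ hν)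
    rw [mul_left_comm, mul_left_comm ν]
    exact hge.trans (mul_le_mul_right hlk _)
  refine ⟨l, hil_eq, hlk.antisymm (le_of_mul_le_mul_left ?_ (hil_eq.apply_pos hμ hw))⟩
  rw [mul_left_comm, show A i l * w l = μ * w i from hil_eq, mul_left_comm]
  exact hge

theorem cycleMean_pow (A : Matrix (Fin n) (Fin n) ℝ≥0) {k : ℕ} (c : Fin (k + 1) → Fin n) :
    cycleMean A c ^ (k + 1) = ∏ t, A (c t) (c (t + 1)) := by
  have := NNReal.rpow_inv_natCast_pow (∏ t, A (c t) (c (t + 1))) k.succ_ne_zero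
  simpa [cycleMean] using this

theorem cycleMean_le_perronRoot (A : Matrix (Fin n) (Fin n) ℝ≥0) {k : ℕ} (hk : k < n)
    (c : Fin (k + 1) → Fin n) : cycleMean A c ≤ perronRoot A :=
  (Finset.le_sup (f := fun c => cycleMean A c) (Finset.mem_univ c)).trans
    (Finset.le_sup (f := fun k => Finset.univ.sup fun c : Fin (k + 1) → Fin n => cycleMean A c)
      (Finset.mem_range.2 hk))

/- Passing from `A` to `diag(w)⁻¹ A diag(w)` does not change the weights of cycles. -/
theorem prod_mul_div_eq (A : Matrix (Fin n) (Fin n) ℝ≥0) (hw : ∀ i, 0 < w i) {k : ℕ}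
    (c : Fin (k + 1) → Fin n) :
    ∏ t, A (c t) (c (t + 1)) * w (c (t + 1)) / w (c t) = ∏ t, A (c t) (c (t + 1)) := by
  have hshift : ∏ t, w (c (t + 1)) = ∏ t, w (c t) :=
    Equiv.prod_comp (Equiv.addRight 1) fun t => w (c t)
  rw [Finset.prod_div_distrib, Finset.prod_mul_distrib, hshift,
    mul_div_cancel_right₀ _ (Finset.prod_pos fun t _ => hw (c t)).ne']

theorem cycleMean_le_of_maxMulVec_le (hw : ∀ i, 0 < w i) (hAw : maxMulVec A w ≤ μ • w) {k : ℕ}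
    (c : Fin (k + 1) → Fin n) : cycleMean A c ≤ μ := by
  refine le_of_pow_le_pow_left₀ k.succ_ne_zero zero_le ?_
  rw [cycleMean_pow, ← prod_mul_div_eq A hw]
  refine (Finset.prod_le_pow_card _ _ μ fun t _ => ?_).trans_eq (by simp)
  rw [div_le_iff₀ (hw _)]
  exact (mul_le_maxMulVec A w _ _).trans (hAw _)

theorem cycleMean_eq_of_isSaturated (hw : ∀ i, 0 < w i) {k : ℕ} {c : Fin (k + 1) → Fin n}
    (hc : ∀ t, IsSaturated A μ w (c t) (c (t + 1))) : cycleMean A c = μ := by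
  refine pow_left_injective k.succ_ne_zero ?_
  change cycleMean A c ^ (k + 1) = μ ^ (k + 1)
  rw [cycleMean_pow, ← prod_mul_div_eq A hw, Finset.prod_eq_pow_card fun t _ =>
    (div_eq_iff (hw _).ne').2 (hc t)]
  simp

theorem perronRoot_eq_of_maxMulVec_eq [Nonempty (Fin n)] (hw : ∀ i, 0 < w i)
    (hAw : maxMulVec A w = μ • w) : perronRoot A = μ := by
  refine le_antisymm (Finset.sup_le fun k _ => Finset.sup_le fun c _ =>
    cycleMean_le_of_maxMulVec_le hw hAw.le c) ?_
  obtain ⟨i, -, hi⟩ := exists_transGen_self (R := IsSaturated A μ w) Set.univ_nonempty fun i _ =>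
    (exists_isSaturated hAw i).imp fun _ h => ⟨trivial, h⟩
  obtain ⟨k, c, hinj, -, hc⟩ := exists_cycle_of_transGen hi
  have hk : k < n := by simpa using Fintype.card_le_of_injective c hinj
  exact (cycleMean_eq_of_isSaturated hw hc).symm.trans_le (cycleMean_le_perronRoot A hk c)

theorem isCriticalCycle_of_isSaturated (hμ : 0 < μ) (hw : ∀ i, 0 < w i)
    (hAw : maxMulVec A w = μ • w) {k : ℕ} {c : Fin (k + 1) → Fin n} (hinj : Function.Injective c)
    (hc : ∀ t, IsSaturated A μ w (c t) (c (t + 1))) : IsCriticalCycle A c := by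
  have : Nonempty (Fin n) := ⟨c 0⟩
  exact ⟨⟨hinj, fun t => (hc t).apply_pos hμ hw⟩,
    (cycleMean_eq_of_isSaturated hw hc).trans (perronRoot_eq_of_maxMulVec_eq hw hAw).symm⟩

theorem IsCriticalCycle.isCycle_crit {k : ℕ} {c : Fin (k + 1) → Fin n} (hc : IsCriticalCycle A c) :
    (crit A).IsCycle c :=
  ⟨hc.1.1, fun t => ⟨k, c, hc, t, rfl, rfl⟩⟩

theorem mem_crit_nodes_of_transGen_isSaturated (hμ : 0 < μ) (hw : ∀ i, 0 < w i)
    (hAw : maxMulVec A w = μ • w) {i : Fin n} (hi : TransGen (IsSaturated A μ w) i i) :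
    i ∈ (crit A).nodes := by
  obtain ⟨k, c, hinj, hc₀, hc⟩ := exists_cycle_of_transGen hi
  exact ⟨k, c, isCriticalCycle_of_isSaturated hμ hw hAw hinj hc, 0, hc₀⟩

theorem MaxCommute.exists_isCycle_crit_forall_mem_crit [Nonempty (Fin n)] (hAB : MaxCommute A B)
    (hμ : 0 < μ) (hν : 0 < ν) (hw : ∀ i, 0 < w i) (hAw : maxMulVec A w = μ • w)
    (hBw : maxMulVec B w = ν • w) :
    ∃ (k : ℕ) (c : Fin (k + 1) → Fin n), (crit A).IsCycle c ∧ ∀ t, c t ∈ (crit B).nodes := by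
  obtain ⟨k, c, hinj, hcA, hcB⟩ := exists_cycle_forall_transGen_self (exists_isSaturated hAw)
    (exists_isSaturated hBw) (hAB.comp_isSaturated_le hμ hν hw hAw hBw)
  exact ⟨k, c, (isCriticalCycle_of_isSaturated hμ hw hAw hinj hcA).isCycle_crit,
    fun t => mem_crit_nodes_of_transGen_isSaturated hν hw hBw (hcB t)⟩

end MaxAlgebra

theorem theoremt_general {n : ℕ} {A B : Matrix (Fin n) (Fin n) ℝ≥0}
    (hA : MaxAlgebra.IsIrreducible A) (hB : B ≠ 0) (hAB : MaxAlgebra.MaxCommute A B) :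
    (∃ (k : ℕ) (c₁ : Fin (k + 1) → Fin n), (MaxAlgebra.crit A).IsCycle c₁ ∧
      ∀ t, ∃ S, (MaxAlgebra.crit B).IsStrongComponent S ∧ c₁ t ∈ S) ∧
    (∃ (k : ℕ) (c₂ : Fin (k + 1) → Fin n), (MaxAlgebra.crit B).IsCycle c₂ ∧
      ∀ t, ∃ S, (MaxAlgebra.crit A).IsStrongComponent S ∧ c₂ t ∈ S) ∧
    (∃ i : Fin n, i ∈ (MaxAlgebra.crit A).nodes ∧ i ∈ (MaxAlgebra.crit B).nodes) := by
  have : Nonempty (Fin n) := by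
    by_contra! hempty
    exact hB (Subsingleton.elim _ _)
  obtain ⟨μ, ν, w, hw, hAw, hBw⟩ := hAB.exists_common_pos_eigenvector hA
  have hμ : 0 < μ := MaxAlgebra.eigenvalue_pos hA.ne_zero hw hAw
  have hν : 0 < ν := MaxAlgebra.eigenvalue_pos hB hw hBw
  obtain ⟨k, c, hc, hcB⟩ := hAB.exists_isCycle_crit_forall_mem_crit hμ hν hw hAw hBw
  obtain ⟨l, d, hd, hdA⟩ := hAB.symm.exists_isCycle_crit_forall_mem_crit hν hμ hw hBw hAw
  exact ⟨⟨k, c, hc, fun t => MaxAlgebra.NodeDigraph.exists_isStrongComponent_mem (hcB t)⟩,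
    ⟨l, d, hd, fun t => MaxAlgebra.NodeDigraph.exists_isStrongComponent_mem (hdA t)⟩,
    c 0, ((MaxAlgebra.crit A).edge_mem (hc.2 0)).1, hcB 0⟩

theorem theoremt (n : ℕ) (hn : 1 ≤ n) (A B : Matrix (Fin n) (Fin n) ℝ≥0)
    (hA : MaxAlgebra.IsIrreducible A) (hB : MaxAlgebra.IsIrreducible B)
    (hAB : MaxAlgebra.MaxCommute A B) :
    (∃ (k : ℕ) (c₁ : Fin (k + 1) → Fin n), (MaxAlgebra.crit A).IsCycle c₁ ∧
      ∀ t, ∃ S, (MaxAlgebra.crit B).IsStrongComponent S ∧ c₁ t ∈ S) ∧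
    (∃ (k : ℕ) (c₂ : Fin (k + 1) → Fin n), (MaxAlgebra.crit B).IsCycle c₂ ∧
      ∀ t, ∃ S, (MaxAlgebra.crit A).IsStrongComponent S ∧ c₂ t ∈ S) ∧
    (∃ i : Fin n, i ∈ (MaxAlgebra.crit A).nodes ∧ i ∈ (MaxAlgebra.crit B).nodes) := by
  have : Nonempty (Fin n) := ⟨⟨0, hn⟩⟩
  exact theoremt_general hA hB.ne_zero hAB
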